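/- Let $\mathcal A$ be a (not necessarily unital) complex $C^*$-algebra. A projection $p=p^*=p^2\in\mathcal A$ is called minimal if $p\mathcal A p=\mathbb C p$, and $\mathcal I^{At}(\mathcal A)$ denotes the $C^*$-subalgebra (norm-closed $*$-subalgebra) of $\mathcal A$ generated by all minimal projections of $\mathcal A$. By an ideal of $\mathcal A$ we mean a norm-closed two-sided ideal (such an ideal is automatically self-adjoint); an ideal $\mathcal I$ is essential if $\mathcal I\cap\mathcal J\neq\{0\}$ for every nonzero ideal $\mathcal J$ of $\mathcal A$. For a complex Hilbert space $\mathcal H$, $\mathcal K(\mathcal H)$ is the $C^*$-algebra of compact operators on $\mathcal H$; subalgebras of $\mathcal K(\mathcal H)$ are $C^*$-subalgebras and isomorphisms are $*$-isomorphisms. Then: \begin{enumerate} \item $\mathcal I^{At}(\mathcal A)$ is an ideal of $\mathcal A$; \item $\mathcal I^{At}(\mathcal A)$ is isomorphic to a subalgebra of $\mathcal K(\mathcal H)$ for some Hilbert space $\mathcal H$; \item every ideal of $\mathcal A$ that is isomorphic to a subalgebra of $\mathcal K(\mathcal H)$ for some Hilbert space $\mathcal H$ is contained in $\mathcal I^{At}(\mathcal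 A)$; \item if an essential ideal $\mathcal I$ of $\mathcal A$ is isomorphic to a subalgebra of $\mathcal K(\mathcal H)$ for some Hilbert space $\mathcal H$, then $\mathcal I=\mathcal I^{At}(\mathcal A)$. \end{enumerate} -/

import Mathlib

universe u v

namespace CStarAtoms

section Defs

variable {A : Type u} [NonUnitalCStarAlgebra A]

/-- A minimal projection of a (not necessarily unital) C⋆-algebra `A`: a self-adjoint idempotent
`p` with `p A p = ℂ p`. The projection `0` formally satisfies this; whether it is counted or not
makes no difference to the algebra generated by the minimal projections. -/
structure IsMinimalProjection (p : A) : Prop where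
  isStarProjection : IsStarProjection p
  corner_eq : Set.range (fun a : A => p * a * p) = Set.range (fun c : ℂ => c • p)

variable (A) in
/-- The C⋆-subalgebra (i.e. norm-closed `*`-subalgebra) of `A` generated by the minimal
projections of `A`. -/
noncomputable def atomicIdeal : NonUnitalStarSubalgebra ℂ A :=
  (NonUnitalStarAlgebra.adjoin ℂ {p : A | IsMinimalProjection p}).topologicalClosure

/-- A linear subspace of a C⋆-algebra is an ideal if it is norm-closed and absorbs multiplication
on both sides. -/
structure IsClosedIdeal (I : Submodule ℂ A) : Prop where
  isClosed : IsClosed (I : Set A)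
  mul_mem_left : ∀ (a : A) {x : A}, x ∈ I → a * x ∈ I
  mul_mem_right : ∀ (a : A) {x : A}, x ∈ I → x * a ∈ I

/-- A closed two-sided ideal of a C⋆-algebra is self-adjoint. -/
theorem IsClosedIdeal.star_mem {I : Submodule ℂ A} (hI : IsClosedIdeal I) {x : A} (hx : x ∈ I) :
    star x ∈ I := by
  have hmem : x * star x ∈ I := hI.mul_mem_right _ hx
  have hsa : IsSelfAdjoint (x * star x) := .mul_star_self x
  set h : A := x * star x with hh
  rw [← SetLike.mem_coe, ← hI.isClosed.closure_eq, Metric.mem_closure_iff]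
  intro ε hε
  -- approximate `star x` by `star x * f h` with `f t = n t² / (1 + n t²)`
  obtain ⟨n, hn⟩ : ∃ n : ℝ, n = 1 / ε ^ 4 := ⟨_, rfl⟩
  have hn0 : 0 < n := by rw [hn]; positivity
  have hpos : ∀ t : ℝ, 0 < 1 + n * t ^ 2 := fun t => by positivity
  let g : ℝ → ℝ := fun t => n * t / (1 + n * t ^ 2)
  let f : ℝ → ℝ := fun t => t * g t
  have hg : Continuous g := by
    refine Continuous.div (by fun_prop) (by fun_prop) fun t => (hpos t).ne'
  have hf : Continuous f := continuous_id.mul hg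
  have hg0 : g 0 = 0 := by simp [g]
  have hf0 : f 0 = 0 := by simp [f]
  have hid : cfcₙ (fun t : ℝ => t) h = h := cfcₙ_id' ℝ h
  have e1 : cfcₙ f h = h * cfcₙ g h := by
    have := cfcₙ_mul (fun t : ℝ => t) g h (by fun_prop) rfl hg.continuousOn hg0
    rwa [hid] at this
  have e2 : cfcₙ (fun t => t * f t) h = h * cfcₙ f h := by
    have := cfcₙ_mul (fun t : ℝ => t) f h (by fun_prop) rfl hf.continuousOn hf0
    rwa [hid] at this
  have hc : Continuous fun t => t - t * f t := by fun_prop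
  have e3 : cfcₙ (fun t => t - t * f t) h = h - h * cfcₙ f h := by
    have := cfcₙ_sub (fun t : ℝ => t) (fun t => t * f t) h (by fun_prop) rfl (by fun_prop)
      (by simp)
    rwa [hid, e2] at this
  have e4 : cfcₙ (fun t => f t * (t - t * f t)) h = cfcₙ f h * (h - h * cfcₙ f h) := by
    rw [← e3]
    exact cfcₙ_mul f _ h hf.continuousOn hf0 hc.continuousOn (by simp)
  have e5 : cfcₙ (fun t => (t - t * f t) - f t * (t - t * f t)) h =
      (h - h * cfcₙ f h) - cfcₙ f h * (h - h * cfcₙ f h) := by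
    rw [← e4, ← e3]
    exact cfcₙ_sub _ _ h hc.continuousOn (by simp) (by fun_prop) (by simp)
  have hfs : star (cfcₙ f h) = cfcₙ f h := (cfcₙ_predicate f h : IsSelfAdjoint _)
  refine ⟨star x * cfcₙ f h, hI.mul_mem_left _ (e1 ▸ hI.mul_mem_right _ hmem), ?_⟩
  have key : star (star x - star x * cfcₙ f h) * (star x - star x * cfcₙ f h) =
      (h - h * cfcₙ f h) - cfcₙ f h * (h - h * cfcₙ f h) := by
    rw [star_sub, star_mul, star_star, hfs, hh]
    simp only [sub_mul, mul_sub, mul_assoc]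
    abel
  have hnorm : ‖star x - star x * cfcₙ f h‖ * ‖star x - star x * cfcₙ f h‖ ≤ ε ^ 2 / 2 := by
    rw [← CStarRing.norm_star_mul_self, key, ← e5]
    refine norm_cfcₙ_le fun t _ => ?_
    have e : (t - t * f t) - f t * (t - t * f t) = t / (1 + n * t ^ 2) ^ 2 := by
      have := (hpos t).ne'
      simp only [f, g]
      field_simp
      ring
    rw [e, norm_div, norm_pow, Real.norm_eq_abs, Real.norm_eq_abs, abs_of_pos (hpos t),
      div_le_iff₀ (by have := hpos t; positivity)]
    have h1 : 1 + n * t ^ 2 ≤ (1 + n * t ^ 2) ^ 2 := by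
      have : 0 ≤ n * t ^ 2 := by positivity
      nlinarith
    have h2 : |t| ≤ ε ^ 2 / 2 * (1 + n * t ^ 2) := by
      have : ε ^ 2 / 2 * (1 + n * t ^ 2) - |t| = (ε ^ 2 - |t|) ^ 2 / (2 * ε ^ 2) := by
        rw [hn, ← sq_abs t]
        field_simp
        ring
      have h3 : 0 ≤ (ε ^ 2 - |t|) ^ 2 / (2 * ε ^ 2) := by positivity
      linarith
    exact h2.trans (by gcongr)
  rw [dist_eq_norm]
  have := norm_nonneg (star x - star x * cfcₙ f h)
  by_contra! hcon
  nlinarith [mul_le_mul hcon hcon hε.le this, pow_pos hε 2]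

/-- A closed two-sided ideal, viewed as a `*`-subalgebra. -/
def IsClosedIdeal.toStarSubalgebra {I : Submodule ℂ A} (hI : IsClosedIdeal I) :
    NonUnitalStarSubalgebra ℂ A where
  carrier := I
  add_mem' := I.add_mem
  zero_mem' := I.zero_mem
  mul_mem' := fun {a _} _ hb => hI.mul_mem_left a hb
  smul_mem' := fun c _ hx => I.smul_mem c hx
  star_mem' := fun hx => hI.star_mem hx

/-- An ideal is essential if it meets every nonzero ideal in a nonzero subspace. -/
def IsEssentialIdeal (I : Submodule ℂ A) : Prop :=
  IsClosedIdeal I ∧ ∀ J : Submodule ℂ A, IsClosedIdeal J → J ≠ ⊥ → I ⊓ J ≠ ⊥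

/-- `B` is `*`-isomorphic to a C⋆-subalgebra of the algebra of compact operators on some complex
Hilbert space (in the universe `v`). -/
def IsIsoToCompactSubalgebra (B : NonUnitalStarSubalgebra ℂ A) : Prop :=
  ∃ (H : Type v) (_ : NormedAddCommGroup H) (_ : InnerProductSpace ℂ H) (_ : CompleteSpace H)
    (C : NonUnitalStarSubalgebra ℂ (H →L[ℂ] H)),
    IsClosed (C : Set (H →L[ℂ] H)) ∧ (∀ T ∈ C, IsCompactOperator T) ∧ Nonempty (B ≃⋆ₐ[ℂ] C)

end Defs

end CStarAtoms

namespace CStarAtoms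

/-! ### The span of the minimal projections is an ideal, and essential ideals contain it. -/

section Ideal

variable {A : Type u} [NonUnitalCStarAlgebra A] {p : A}

/-! If `p ≠ 0` is minimal and `x = x p`, then `x⋆ x = ‖x‖² p`, so `x x⋆` is a multiple of a minimal
projection. Polarization then puts `A p` in the span of the minimal projections; this span is
therefore an ideal, as is its closure.

The same identity makes `A p` a Hilbert space on which `A` acts by left multiplication. Take one `p`
from each class of atoms, where `p ~ q` means `q A p ≠ 0`, and sum the spaces. An atom then has rank
one, acting only on the summand of its class; with all atoms as summands it would act on every
equivalent one, and compactness could fail. So the atomic ideal acts by compact operators, and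
faithfully, since an element of the kernel kills every atom.

Conversely, let `I` be an ideal represented faithfully by compact operators. Functional calculus
approximates a self-adjoint element of `I` by some `f` having a local unit `e` in `I`. The compact
operator of `e` fixes the range of that of `f`, so `f A f` is finite-dimensional and `f` is a
combination of minimal projections (`finiteDimensional_corner`, `mem_span_isMinimalProjection`).

For an essential ideal the reverse inclusion holds because a minimal projection outside `I` would
lie in the annihilator of `I`, which meets `I` only in zero. -/

theorem IsMinimalProjection.exists_smul (hp : IsMinimalProjection p) (a : A) :
    ∃ c : ℂ, p * a * p = c • p := by
  have : p * a * p ∈ Set.range (fun c : ℂ => c • p) := hp.corner_eq ▸ ⟨a, rfl⟩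
  obtain ⟨c, hc⟩ := this
  exact ⟨c, hc.symm⟩

theorem IsMinimalProjection.mul_self (hp : IsMinimalProjection p) : p * p = p :=
  hp.isStarProjection.isIdempotentElem

theorem IsMinimalProjection.star_eq (hp : IsMinimalProjection p) : star p = p :=
  hp.isStarProjection.isSelfAdjoint

theorem isMinimalProjection_of_exists_smul (hp : IsStarProjection p)
    (h : ∀ a, ∃ c : ℂ, p * a * p = c • p) : IsMinimalProjection p := by
  refine ⟨hp, Set.Subset.antisymm ?_ ?_⟩
  · rintro _ ⟨a, rfl⟩
    obtain ⟨c, hc⟩ := h a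
    exact ⟨c, hc.symm⟩
  · rintro _ ⟨c, rfl⟩
    have := hp.isIdempotentElem.eq
    exact ⟨c • p, by simp only [mul_smul_comm, smul_mul_assoc, this]⟩

/-- For `x = x p` with `p` a nonzero minimal projection, `x⋆ x = ‖x‖² p`. -/
theorem IsMinimalProjection.star_mul_self_eq (hp : IsMinimalProjection p) (hp0 : p ≠ 0)
    {x : A} (hx : x * p = x) : star x * x = ((‖x‖ ^ 2 : ℝ) : ℂ) • p := by
  have hpn : 0 < ‖p‖ := norm_pos_iff.2 hp0
  obtain ⟨c, hc⟩ := hp.exists_smul (star x * x)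
  have hpx : p * star x = star x := by
    have := congrArg star hx
    rwa [star_mul, hp.star_eq] at this
  have hc' : star x * x = c • p := by
    rw [← hc, ← mul_assoc, hpx, mul_assoc, hx]
  have hn : ‖p‖ = 1 := by
    have := CStarRing.norm_star_mul_self (x := p)
    rw [hp.star_eq, hp.mul_self] at this
    nlinarith
  have hcn : ‖c‖ = ‖x‖ ^ 2 := by
    have := CStarRing.norm_star_mul_self (x := x)
    rw [hc', norm_smul, hn] at this
    nlinarith
  have hreal : ((c.re : ℝ) : ℂ) = c := by
    have h1 : star (star x * x) = star x * x := by simp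
    rw [hc', star_smul, hp.star_eq] at h1
    exact Complex.conj_eq_iff_re.1 (smul_left_injective ℂ hp0 h1)
  have hpos : 0 ≤ c.re := by
    -- If `c < 0`, then `-c p` is also of the form `y⋆ y`, so `c p` is both nonnegative and
    -- nonpositive, hence zero.
    by_contra! hneg
    let _ := CStarAlgebra.spectralOrder A
    have _ := CStarAlgebra.spectralOrderedRing A
    have h1 : 0 ≤ c • p := hc' ▸ star_mul_self_nonneg x
    have h2 : 0 ≤ (-c) • p := by
      have h3 := star_mul_self_nonneg ((Real.sqrt (-c.re) : ℂ) • p)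
      rw [star_smul, hp.star_eq, smul_mul_smul_comm, hp.mul_self] at h3
      convert h3 using 2
      rw [← hreal]
      simp only [RCLike.star_def, Complex.conj_ofReal, ← Complex.ofReal_mul, Complex.ofReal_re]
      rw [Real.mul_self_sqrt (by linarith)]
      simp
    rw [neg_smul] at h2
    have h4 : c • p = 0 := le_antisymm (neg_nonneg.1 h2) h1
    rcases smul_eq_zero.1 h4 with h5 | h5
    · simp [h5] at hneg
    · exact hp0 h5
  rw [hc', ← hcn, ← hreal, Complex.norm_real, Real.norm_of_nonneg hpos]

/-- A multiple of `x` is a partial isometry with source `p`; its range projection `l⁻¹ x x⋆`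
inherits minimality because `x⋆ a x` lies in `p A p`. -/
theorem IsMinimalProjection.mul_star_mem_span (hp : IsMinimalProjection p) {x : A}
    (hx : x * p = x) : x * star x ∈ Submodule.span ℂ {q : A | IsMinimalProjection q} := by
  rcases eq_or_ne p 0 with rfl | hp0
  · rw [mul_zero] at hx
    simp [hx.symm]
  rcases eq_or_ne x 0 with rfl | hx0
  · simp
  have hl : ((‖x‖ ^ 2 : ℝ) : ℂ) ≠ 0 := by
    simpa using hx0
  have key := hp.star_mul_self_eq hp0 hx
  set l : ℂ := ((‖x‖ ^ 2 : ℝ) : ℂ) with hldef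
  have hpx : p * star x = star x := by
    have := congrArg star hx
    rwa [star_mul, hp.star_eq] at this
  have hmin : IsMinimalProjection (l⁻¹ • (x * star x)) := by
    refine isMinimalProjection_of_exists_smul ⟨?_, ?_⟩ fun a => ?_
    · change (l⁻¹ • (x * star x)) * (l⁻¹ • (x * star x)) = _
      rw [smul_mul_smul_comm, mul_assoc x, ← mul_assoc (star x), key, smul_mul_assoc, hpx,
        mul_smul_comm, smul_smul, mul_assoc, inv_mul_cancel₀ hl, mul_one]
    · change star (l⁻¹ • (x * star x)) = _
      rw [star_smul, star_mul, star_star, hldef, star_inv₀, RCLike.star_def, Complex.conj_ofReal]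
    · obtain ⟨c, hc⟩ := hp.exists_smul (star x * a * x)
      refine ⟨l⁻¹ * c, ?_⟩
      have h1 : star x * a * x = c • p := by
        rw [← hc]
        simp only [← mul_assoc, hpx]
        rw [mul_assoc (star x * a), hx]
      have h2 : x * star x * a * (x * star x) = c • (x * star x) := by
        calc x * star x * a * (x * star x) = x * (star x * a * x) * star x := by
              simp only [mul_assoc]
          _ = c • (x * star x) := by rw [h1, mul_smul_comm, smul_mul_assoc, hx]
      rw [smul_mul_assoc, smul_mul_assoc, mul_smul_comm, h2]
      simp only [smul_smul]
      congr 1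
      ring
  have := Submodule.smul_mem _ l (Submodule.subset_span (R := ℂ) hmin)
  rwa [smul_smul, mul_inv_cancel₀ hl, one_smul] at this

/-- By polarization, `a p` is a combination of four minimal projections. -/
theorem IsMinimalProjection.mul_mem_span (hp : IsMinimalProjection p) (a : A) :
    a * p ∈ Submodule.span ℂ {q : A | IsMinimalProjection q} := by
  have h (c : ℂ) : (a * p + c • p) * star (a * p + c • p) ∈
      Submodule.span ℂ {q : A | IsMinimalProjection q} := by
    refine hp.mul_star_mem_span ?_
    rw [add_mul, mul_assoc, smul_mul_assoc, hp.mul_self]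
  -- This is `4 y z⋆ = ∑ c (y + c z)(y + c z)⋆` over the fourth roots of unity `c`, with `y = a p`
  -- and `z = p`.
  have e : a * p = (4⁻¹ : ℂ) • ((a * p + (1 : ℂ) • p) * star (a * p + (1 : ℂ) • p)
      - (a * p + (-1 : ℂ) • p) * star (a * p + (-1 : ℂ) • p)
      + Complex.I • ((a * p + Complex.I • p) * star (a * p + Complex.I • p))
      - Complex.I • ((a * p + (-Complex.I) • p) * star (a * p + (-Complex.I) • p))) := by
    simp only [star_add, star_smul, star_mul, hp.star_eq, add_mul, mul_add, smul_mul_assoc,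
      mul_smul_comm, smul_add, smul_smul]
    have : a * p * p = a * p := by rw [mul_assoc, hp.mul_self]
    have h2 : p * (p * star a) = p * star a := by rw [← mul_assoc, hp.mul_self]
    simp only [this, h2, hp.mul_self, RCLike.star_def, map_neg, map_one, Complex.conj_I]
    match_scalars <;> (ring_nf; try norm_num [Complex.I_sq, Complex.I_pow_four])
  rw [e]
  exact Submodule.smul_mem _ _ (Submodule.sub_mem _ (Submodule.add_mem _ (Submodule.sub_mem _
    (h _) (h _)) (Submodule.smul_mem _ _ (h _))) (Submodule.smul_mem _ _ (h _)))

theorem mul_mem_span (a : A) {x : A} (hx : x ∈ Submodule.span ℂ {q : A | IsMinimalProjection q}) :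
    a * x ∈ Submodule.span ℂ {q : A | IsMinimalProjection q} := by
  induction hx using Submodule.span_induction with
  | mem p hp => exact IsMinimalProjection.mul_mem_span hp a
  | zero => simp
  | add x y _ _ hx hy => exact mul_add a x y ▸ Submodule.add_mem _ hx hy
  | smul c x _ hx => exact mul_smul_comm c a x ▸ Submodule.smul_mem _ c hx

theorem star_mem_span {x : A} (hx : x ∈ Submodule.span ℂ {q : A | IsMinimalProjection q}) :
    star x ∈ Submodule.span ℂ {q : A | IsMinimalProjection q} := by
  induction hx using Submodule.span_induction with
  | mem p hp => exact (IsMinimalProjection.star_eq hp).symm ▸ Submodule.subset_span hp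
  | zero => simp
  | add x y _ _ hx hy => exact star_add x y ▸ Submodule.add_mem _ hx hy
  | smul c x _ hx => exact star_smul c x ▸ Submodule.smul_mem _ _ hx

/-- The span is already a `*`-subalgebra, being a self-adjoint left ideal. -/
theorem mem_adjoin_iff_mem_span {x : A} :
    x ∈ NonUnitalStarAlgebra.adjoin ℂ {p : A | IsMinimalProjection p} ↔
      x ∈ Submodule.span ℂ {p : A | IsMinimalProjection p} := by
  refine ⟨fun hx => ?_, fun hx => ?_⟩
  · induction hx using NonUnitalStarAlgebra.adjoin_induction with
    | mem p hp => exact Submodule.subset_span hp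
    | add x y _ _ hx hy => exact Submodule.add_mem _ hx hy
    | zero => exact Submodule.zero_mem _
    | mul x y _ _ _ hy => exact mul_mem_span x hy
    | smul r x _ hx => exact Submodule.smul_mem _ r hx
    | star x _ hx => exact star_mem_span hx
  · have h : Submodule.span ℂ {q : A | IsMinimalProjection q} ≤
        (NonUnitalStarAlgebra.adjoin ℂ {p : A | IsMinimalProjection p}).toSubmodule :=
      Submodule.span_le.2 (NonUnitalStarAlgebra.subset_adjoin ℂ _)
    exact h hx

theorem adjoin_le_atomicIdeal :
    NonUnitalStarAlgebra.adjoin ℂ {p : A | IsMinimalProjection p} ≤ atomicIdeal A :=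
  NonUnitalStarSubalgebra.le_topologicalClosure _

theorem isClosed_atomicIdeal : IsClosed (atomicIdeal A : Set A) :=
  NonUnitalStarSubalgebra.isClosed_topologicalClosure _

theorem mul_mem_adjoin (a : A) {x : A}
    (hx : x ∈ NonUnitalStarAlgebra.adjoin ℂ {p : A | IsMinimalProjection p}) :
    a * x ∈ NonUnitalStarAlgebra.adjoin ℂ {p : A | IsMinimalProjection p} :=
  mem_adjoin_iff_mem_span.2 (mul_mem_span a (mem_adjoin_iff_mem_span.1 hx))

theorem mem_adjoin_mul (a : A) {x : A}
    (hx : x ∈ NonUnitalStarAlgebra.adjoin ℂ {p : A | IsMinimalProjection p}) :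
    x * a ∈ NonUnitalStarAlgebra.adjoin ℂ {p : A | IsMinimalProjection p} := by
  have := star_mem (mul_mem_adjoin (star a) (star_mem hx))
  rwa [star_mul, star_star, star_star] at this

theorem isClosedIdeal_atomicIdeal : IsClosedIdeal (atomicIdeal A).toSubmodule where
  isClosed := isClosed_atomicIdeal
  mul_mem_left a _ hx := map_mem_closure (continuous_const_mul a) hx
    fun _ hy => mul_mem_adjoin a hy
  mul_mem_right a _ hx := map_mem_closure (f := (· * a)) (continuous_mul_const a) hx
    fun _ hy => mem_adjoin_mul a hy

/-- The right annihilator of a closed ideal. -/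
def IsClosedIdeal.annihilator {I : Submodule ℂ A} (_ : IsClosedIdeal I) : Submodule ℂ A where
  carrier := {a | ∀ x ∈ I, x * a = 0}
  add_mem' := fun ha hb x hx => by rw [mul_add, ha x hx, hb x hx, add_zero]
  zero_mem' := fun x _ => mul_zero x
  smul_mem' := fun c a ha x hx => by rw [mul_smul_comm, ha x hx, smul_zero]

theorem IsClosedIdeal.isClosedIdeal_annihilator {I : Submodule ℂ A} (hI : IsClosedIdeal I) :
    IsClosedIdeal hI.annihilator where
  isClosed := by
    have : (hI.annihilator : Set A) = ⋂ x ∈ I, {a | x * a = 0} := by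
      ext; simp [annihilator]
    rw [this]
    exact isClosed_biInter fun x _ => isClosed_eq (continuous_const_mul x) continuous_const
  mul_mem_left b a ha x hx := by rw [← mul_assoc, ha _ (hI.mul_mem_right b hx)]
  mul_mem_right b a ha x hx := by rw [← mul_assoc, ha x hx, zero_mul]

theorem IsClosedIdeal.inf_annihilator {I : Submodule ℂ A} (hI : IsClosedIdeal I) :
    I ⊓ hI.annihilator = ⊥ := by
  refine (Submodule.eq_bot_iff _).2 fun x hx => ?_
  exact CStarRing.star_mul_self_eq_zero_iff x |>.1 (hx.2 _ (hI.star_mem hx.1))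

/-- An essential ideal contains every minimal projection. -/
theorem IsEssentialIdeal.mem_of_isMinimalProjection {I : Submodule ℂ A} (hI : IsEssentialIdeal I)
    (hp : IsMinimalProjection p) : p ∈ I := by
  by_contra hpI
  refine hI.2 _ hI.1.isClosedIdeal_annihilator (fun hbot => ?_) hI.1.inf_annihilator
  -- For `x ∈ I` the element `p x⋆ x p = c p` lies in `I`, so `p ∉ I` forces `c = 0`, that is `x p =
  -- 0`.
  have hmem : p ∈ hI.1.annihilator := fun x hx => by
    obtain ⟨c, hc⟩ := hp.exists_smul (star x * x)
    rcases eq_or_ne c 0 with rfl | hc0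
    · refine CStarRing.star_mul_self_eq_zero_iff (x * p) |>.1 ?_
      rw [star_mul, hp.star_eq, mul_assoc, ← mul_assoc (star x), ← mul_assoc, hc, zero_smul]
    · refine absurd ?_ hpI
      have h1 := hI.1.mul_mem_right p (hI.1.mul_mem_left p (hI.1.mul_mem_left (star x) hx))
      rw [hc] at h1
      exact (I.smul_mem_iff hc0).1 h1
  rw [hbot] at hmem
  exact hpI ((Submodule.mem_bot ℂ).1 hmem ▸ I.zero_mem)

theorem IsEssentialIdeal.atomicIdeal_le {I : Submodule ℂ A} (hI : IsEssentialIdeal I) :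
    (atomicIdeal A).toSubmodule ≤ I :=
  NonUnitalStarSubalgebra.topologicalClosure_minimal (t := hI.1.toStarSubalgebra) _
    (NonUnitalStarAlgebra.adjoin_le fun _ hp => hI.mem_of_isMinimalProjection hp) hI.1.isClosed

end Ideal

/-! ### Spectral decomposition of elements with finite-dimensional corners. -/

section FiniteDimensional

variable {A : Type u} [NonUnitalCStarAlgebra A]

/-- The subspace `x A x`. -/
def corner (x : A) : Submodule ℂ A := LinearMap.range (LinearMap.mulLeftRight ℂ (x, x))

theorem mem_corner {x y : A} : y ∈ corner x ↔ ∃ a, x * a * x = y := by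
  simp [corner, LinearMap.mulLeftRight_apply]

theorem corner_le_corner {x y z : A} (h : x * y * x = z) : corner z ≤ corner x := by
  rintro _ ⟨a, rfl⟩
  refine mem_corner.2 ⟨y * x * a * x * y, ?_⟩
  rw [LinearMap.mulLeftRight_apply]
  simp only [← h, mul_assoc]

/-- The linear map sending a polynomial `q` to `x³ q(x)`. -/
noncomputable def cubeMulAeval (x : A) : Polynomial ℂ →ₗ[ℂ] A where
  toFun q := cfcₙ (fun t : ℂ => t ^ 3 * q.eval t) x
  map_add' q r := by
    rw [← cfcₙ_add (fun t : ℂ => t ^ 3 * q.eval t) (fun t : ℂ => t ^ 3 * r.eval t) x]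
    congr! 2
    rw [Polynomial.eval_add, mul_add]
  map_smul' c q := by
    rw [RingHom.id_apply, ← cfcₙ_smul c (fun t : ℂ => t ^ 3 * q.eval t) x]
    congr! 2
    rw [Polynomial.eval_smul, smul_eq_mul, smul_eq_mul, mul_left_comm]

theorem mul_cfcₙ_mul_self (x : A) [IsStarNormal x] (g : ℂ → ℂ)
    (hg : ContinuousOn g (quasispectrum ℂ x)) (hg0 : g 0 = 0) :
    x * cfcₙ g x * x = cfcₙ (fun t => t * g t * t) x := by
  rw [cfcₙ_mul (fun t => t * g t) (fun t => t) x (continuousOn_id.mul hg) (by simp)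
    continuousOn_id rfl, cfcₙ_mul (fun t => t) g x continuousOn_id rfl hg hg0, cfcₙ_id' ℂ x]

/-- The space of polynomials is infinite-dimensional, so some `q ≠ 0` has `x³ q(x) = 0`, and the
quasispectrum consists of roots of `t³ q(t)`. -/
theorem finite_quasispectrum (x : A) [IsStarNormal x] [FiniteDimensional ℂ (corner x)] :
    (quasispectrum ℂ x).Finite := by
  have hmem (q : Polynomial ℂ) : cubeMulAeval x q ∈ corner x := by
    -- The cube leaves one factor `t` after removing the outer two, so that the middle function
    -- vanishes at `0` as the non-unital calculus requires.
    refine mem_corner.2 ⟨cfcₙ (fun t : ℂ => t * q.eval t) x, ?_⟩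
    rw [mul_cfcₙ_mul_self x _ (by fun_prop) (by simp)]
    change _ = cfcₙ _ x
    congr! 2
    ring
  obtain ⟨q, hq, hq0⟩ : ∃ q, cubeMulAeval x q = 0 ∧ q ≠ 0 := by
    by_contra! hinj
    have h1 : Function.Injective ((cubeMulAeval x).codRestrict (corner x) hmem) := by
      refine (injective_iff_map_eq_zero _).2 fun q hq => hinj q ?_
      simpa using congrArg Subtype.val hq
    exact Polynomial.not_finite (R := ℂ) (Module.Finite.of_injective _ h1)
  have h1 : cfcₙ (fun t : ℂ => t ^ 3 * q.eval t) x = cfcₙ (fun _ : ℂ => 0) x := by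
    rw [cfcₙ_const_zero]
    exact hq
  have hne : Polynomial.X ^ 3 * q ≠ 0 := mul_ne_zero (by simp) hq0
  refine (Polynomial.finite_setOfPred_isRoot hne).subset fun t ht => ?_
  have h2 : t ^ 3 * q.eval t = 0 := (cfcₙ_eq_cfcₙ_iff_eqOn (a := x)).1 h1 ht
  simpa [Polynomial.IsRoot] using h2

/-- If `x A x` is finite-dimensional then the normal element `x` is a combination of projections
in `x A x`. -/
theorem mem_span_isStarProjection (x : A) [IsStarNormal x] [FiniteDimensional ℂ (corner x)] :
    x ∈ Submodule.span ℂ {e : A | IsStarProjection e ∧ e ∈ corner x} := by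
  classical
  have hfin := finite_quasispectrum x
  have hcont (f : ℂ → ℂ) : ContinuousOn f (quasispectrum ℂ x) := hfin.continuousOn f
  have hid : cfcₙ (fun t : ℂ => t) x = x := cfcₙ_id' ℂ x
  have hsum : x = ∑ l ∈ hfin.toFinset.erase 0,
      l • cfcₙ (fun t : ℂ => if t = l then 1 else 0) x := by
    conv_lhs => rw [← hid]
    rw [Finset.sum_congr rfl fun l hl => (cfcₙ_smul l (fun t : ℂ => if t = l then 1 else 0) x
      (hcont _) (if_neg (Finset.ne_of_mem_erase hl).symm)).symm,
      ← cfcₙ_sum _ _ _ (fun l _ => hcont _) fun l hl => by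
        simp [(Finset.ne_of_mem_erase hl).symm]]
    refine cfcₙ_congr fun t ht => ?_
    rcases eq_or_ne t 0 with rfl | ht0 <;> simp_all
  rw [hsum]
  refine Submodule.sum_mem _ fun l hl => Submodule.smul_mem _ _ (Submodule.subset_span ?_)
  have hl0 : l ≠ 0 := Finset.ne_of_mem_erase hl
  -- The rewrite by `hsum` also replaced the `x` inside `corner x`; this restores it.
  rw [← hsum]
  -- The factor `l⁻²` compensates for multiplying by `x` on both sides at the eigenvalue `l`.
  refine ⟨⟨?_, ?_⟩, mem_corner.2 ⟨cfcₙ (fun t : ℂ => if t = l then (l ^ 2)⁻¹ else 0) x, ?_⟩⟩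
  · change _ * _ = _
    rw [← cfcₙ_mul (fun t => if t = l then 1 else 0) (fun t => if t = l then 1 else 0) x (hcont _)
      (if_neg hl0.symm) (hcont _) (if_neg hl0.symm)]
    congr! 2
    simp
  · change star _ = _
    rw [← cfcₙ_star]
    congr! 2
    split_ifs <;> simp
  · rw [mul_cfcₙ_mul_self x (fun t => if t = l then (l ^ 2)⁻¹ else 0) (hcont _) (if_neg hl0.symm)]
    congr! 2 with t
    split_ifs with h
    · subst h; field_simp
    · simp

theorem isStarProjection_sub {e q : A} (he : IsStarProjection e) (hq : IsStarProjection q)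
    (h1 : e * q = q) (h2 : q * e = q) : IsStarProjection (e - q) := by
  refine ⟨?_, he.isSelfAdjoint.sub hq.isSelfAdjoint⟩
  change (e - q) * (e - q) = _
  rw [mul_sub, sub_mul, sub_mul, he.isIdempotentElem.eq, hq.isIdempotentElem.eq, h1, h2]
  abel

theorem corner_lt_corner {e q : A} (he : IsStarProjection e) (hq : IsStarProjection q)
    (h1 : e * q = q) (h2 : q * e = q) (hne : q ≠ e) : corner q < corner e := by
  refine lt_of_le_of_ne (corner_le_corner (y := q) (by rw [h1, h2])) fun h => hne ?_
  have : e ∈ corner q := h ▸ mem_corner.2 ⟨e, by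
    rw [he.isIdempotentElem.eq, he.isIdempotentElem.eq]⟩
  obtain ⟨a, ha⟩ := mem_corner.1 this
  rw [← h2, ← ha, ← mul_assoc, ← mul_assoc, hq.isIdempotentElem.eq]

/-- A projection with a finite-dimensional corner is a combination of minimal projections. -/
theorem isStarProjection_mem_span_isMinimalProjection (n : ℕ) :
    ∀ e : A, IsStarProjection e → FiniteDimensional ℂ (corner e) →
      Module.finrank ℂ (corner e) ≤ n → e ∈ Submodule.span ℂ {p : A | IsMinimalProjection p} := by
  induction n using Nat.strong_induction_on with
  | _ n ih =>
  intro e he hfd hn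
  -- If `0` and `e` are the only projections of the corner, its self-adjoint elements are multiples
  -- of `e`, so `e` is minimal. Otherwise `e = (e - q) + q` splits into projections with strictly
  -- smaller corners.
  by_cases hproj : ∀ q : A, IsStarProjection q → q ∈ corner e → q = 0 ∨ q = e
  · refine Submodule.subset_span (isMinimalProjection_of_exists_smul he fun a => ?_)
    have hsa (y : A) (hy : IsSelfAdjoint y) : e * y * e ∈ Submodule.span ℂ {e} := by
      have hsa' : IsSelfAdjoint (e * y * e) := by
        have := hy.conjugate e
        rwa [he.isSelfAdjoint.star_eq] at this
      have hle : corner (e * y * e) ≤ corner e := corner_le_corner rfl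
      have : FiniteDimensional ℂ (corner (e * y * e)) :=
        Submodule.finiteDimensional_of_le hle
      have : IsStarNormal (e * y * e) := hsa'.isStarNormal
      refine Submodule.span_le.2 ?_ (mem_span_isStarProjection (e * y * e))
      rintro q ⟨hq, hq'⟩
      rcases hproj q hq (hle hq') with rfl | rfl
      · exact Submodule.zero_mem _
      · exact Submodule.mem_span_singleton_self _
    have h := realPart_add_I_smul_imaginaryPart a
    have : e * a * e ∈ Submodule.span ℂ {e} := by
      rw [← h, mul_add, add_mul, mul_smul_comm, smul_mul_assoc]
      exact Submodule.add_mem _ (hsa _ (realPart a).2)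
        (Submodule.smul_mem _ _ (hsa _ (imaginaryPart a).2))
    obtain ⟨c, hc⟩ := Submodule.mem_span_singleton.1 this
    exact ⟨c, hc.symm⟩
  · push Not at hproj
    obtain ⟨q, hq, hqe, hq0, hne⟩ := hproj
    obtain ⟨a, ha⟩ := mem_corner.1 hqe
    have h1 : e * q = q := by rw [← ha, ← mul_assoc, ← mul_assoc, he.isIdempotentElem.eq]
    have h2 : q * e = q := by rw [← ha, mul_assoc, he.isIdempotentElem.eq]
    have hr := isStarProjection_sub he hq h1 h2
    have hlt (r : A) (hr : IsStarProjection r) (h1 : e * r = r) (h2 : r * e = r) (hne : r ≠ e) :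
        r ∈ Submodule.span ℂ {p : A | IsMinimalProjection p} := by
      have hlt := corner_lt_corner he hr h1 h2 hne
      have := Submodule.finiteDimensional_of_le hlt.le
      exact ih _ ((Submodule.finrank_lt_finrank_of_lt hlt).trans_le hn) r hr this le_rfl
    rw [← sub_add_cancel e q]
    refine Submodule.add_mem _ (hlt _ hr ?_ ?_ ?_) (hlt q hq h1 h2 hne)
    · rw [mul_sub, h1, he.isIdempotentElem.eq]
    · rw [sub_mul, h2, he.isIdempotentElem.eq]
    · simpa using hq0

theorem mem_span_isMinimalProjection (x : A) [IsStarNormal x] [FiniteDimensional ℂ (corner x)] :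
    x ∈ Submodule.span ℂ {p : A | IsMinimalProjection p} := by
  refine Submodule.span_le.2 ?_ (mem_span_isStarProjection x)
  rintro e ⟨he, hex⟩
  obtain ⟨a, ha⟩ := mem_corner.1 hex
  have := Submodule.finiteDimensional_of_le (corner_le_corner ha)
  exact isStarProjection_mem_span_isMinimalProjection _ e he this le_rfl

end FiniteDimensional

/-! ### Ideals of compact operators lie in the atomic ideal. -/

section Compact

/-- If a compact operator `E` fixes the range of `F`, the space of the operators `F S F` is
finite-dimensional. -/
theorem exists_finiteDimensional_of_comp_eq {H : Type v} [NormedAddCommGroup H]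
    [InnerProductSpace ℂ H] {E F : H →L[ℂ] H} (hE : IsCompactOperator E)
    (hEF : E * F = F) : ∃ W : Submodule ℂ (H →ₗ[ℂ] H), FiniteDimensional ℂ W ∧
      ∀ S : H →L[ℂ] H, ((F * S * F : H →L[ℂ] H) : H →ₗ[ℂ] H) ∈ W := by
  -- On the fixed space `K` of `E` the identity is compact, so `K` is finite-dimensional; `F` maps
  -- into `K`, and `F S F` factors through an endomorphism of `K`.
  let K : Submodule ℂ H := LinearMap.ker ((1 - E : H →L[ℂ] H) : H →ₗ[ℂ] H)
  have hK (x : H) : x ∈ K ↔ E x = x := by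
    change x - E x = 0 ↔ _
    rw [sub_eq_zero, eq_comm]
  have hKc : IsClosed (K : Set H) := (1 - E : H →L[ℂ] H).isClosed_ker
  have hfd : FiniteDimensional ℂ K := by
    refine FiniteDimensional.of_isCompactOperator_id ?_
    have h1 := hE.restrict (f := (E : H →ₗ[ℂ] H)) (V := K)
      (fun x hx => by simpa [(hK x).1 hx] using hx) hKc
    have h2 : (id : K → K) = (E : H →ₗ[ℂ] H).restrict
        (fun x hx => by simpa [(hK x).1 hx] using hx) := by
      ext x
      exact ((hK x).1 x.2).symm
    rwa [h2]
  have hF (x : H) : F x ∈ K := (hK _).2 (congrArg (· x) hEF)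
  let F' : H →ₗ[ℂ] K := (F : H →ₗ[ℂ] H).codRestrict K hF
  let Ψ : (K →ₗ[ℂ] K) →ₗ[ℂ] (H →ₗ[ℂ] H) :=
    (LinearMap.lcomp ℂ H F').comp (LinearMap.compRight ℂ K.subtype)
  refine ⟨LinearMap.range Ψ, inferInstance, fun S =>
    ⟨F'.comp ((S : H →ₗ[ℂ] H).comp K.subtype), ?_⟩⟩
  ext x
  rfl

variable {A : Type u} [NonUnitalCStarAlgebra A]

/-- If `φ` represents the ideal `I` faithfully by compact operators, and `e, f ∈ I` satisfy
`e f = f = f e`, then `f A f` is finite-dimensional. -/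
theorem finiteDimensional_corner {I : Submodule ℂ A} (hI : IsClosedIdeal I) {H : Type v}
    [NormedAddCommGroup H] [InnerProductSpace ℂ H] [CompleteSpace H]
    {C : NonUnitalStarSubalgebra ℂ (H →L[ℂ] H)} (hC : ∀ T ∈ C, IsCompactOperator T)
    (φ : hI.toStarSubalgebra ≃⋆ₐ[ℂ] C) {e f : A} (he : e ∈ I) (hf : f ∈ I) (hef : e * f = f)
    (hfe : f * e = f) : FiniteDimensional ℂ (corner f) := by
  let e' : hI.toStarSubalgebra := ⟨e, he⟩
  let f' : hI.toStarSubalgebra := ⟨f, hf⟩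
  have hef' : e' * f' = f' := Subtype.ext hef
  obtain ⟨W, hW, hW'⟩ := exists_finiteDimensional_of_comp_eq (F := (φ f' : H →L[ℂ] H))
    (hC _ (φ e').2) (by
      have := congrArg (fun z => (φ z : H →L[ℂ] H)) hef'
      simpa using this)
  have hle : ∀ y ∈ corner f, y ∈ I := by
    rintro y hy
    obtain ⟨a, rfl⟩ := mem_corner.1 hy
    exact hI.mul_mem_left _ hf
  let Φ : corner f →ₗ[ℂ] (H →ₗ[ℂ] H) :=
    { toFun y := ((φ ⟨y, hle y y.2⟩ : H →L[ℂ] H) : H →ₗ[ℂ] H)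
      map_add' y z := by
        have : (⟨(y + z : corner f), hle _ (y + z).2⟩ : hI.toStarSubalgebra) =
          ⟨y, hle y y.2⟩ + ⟨z, hle z z.2⟩ := rfl
        rw [this, map_add]
        rfl
      map_smul' c y := by
        have : (⟨(c • y : corner f), hle _ (c • y).2⟩ : hI.toStarSubalgebra) =
          c • ⟨y, hle y y.2⟩ := rfl
        rw [this, map_smul]
        rfl }
  have hΦ (y : corner f) : Φ y ∈ W := by
    obtain ⟨y, hy⟩ := y
    obtain ⟨a, rfl⟩ := mem_corner.1 hy
    -- `a` need not lie in `I`, where `φ` is defined, but `f a f = f (e a) f` and `e a ∈ I`.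
    let b : hI.toStarSubalgebra := ⟨e * a, hI.mul_mem_right a he⟩
    have h1 : (⟨f * a * f, hle _ hy⟩ : hI.toStarSubalgebra) = f' * b * f' := by
      refine Subtype.ext ?_
      change _ = f * (e * a) * f
      rw [← mul_assoc f e, hfe]
    change ((φ ⟨f * a * f, _⟩ : H →L[ℂ] H) : H →ₗ[ℂ] H) ∈ W
    rw [h1, map_mul, map_mul]
    exact hW' _
  have hinj : Function.Injective (Φ.codRestrict W hΦ) := by
    intro y z hyz
    have h1 : Φ y = Φ z := congrArg Subtype.val hyz
    have h2 := φ.injective (Subtype.ext (ContinuousLinearMap.coe_injective h1))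
    exact Subtype.ext (Subtype.mk.inj h2)
  exact Module.Finite.of_injective _ hinj

/-- An ideal isomorphic to an algebra of compact operators lies in the atomic ideal: soft
thresholding approximates its self-adjoint elements by elements with finite-dimensional corners. -/
theorem le_atomicIdeal_of_compact {I : Submodule ℂ A} (hI : IsClosedIdeal I)
    (h : IsIsoToCompactSubalgebra.{u, v} hI.toStarSubalgebra) :
    I ≤ (atomicIdeal A).toSubmodule := by
  obtain ⟨H, _, _, _, C, -, hC, ⟨φ⟩⟩ := h
  have hsa (x : A) (hx : x ∈ I) (hx' : IsSelfAdjoint x) : x ∈ atomicIdeal A := by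
    rw [← SetLike.mem_coe, ← isClosed_atomicIdeal.closure_eq, Metric.mem_closure_iff]
    intro ε hε
    have hmax (t : ℝ) : 0 < max (t ^ 2) ((ε / 2) ^ 2) := lt_max_of_lt_right (by positivity)
    -- `t k(t) = 1` for `|t| ≥ ε / 2`, while `f` vanishes for `|t| ≤ ε / 2`; hence `t k(t)` is a
    -- local unit for `f`. The difference `t - f t` is `t` clamped to `[-ε / 2, ε / 2]`.
    let k : ℝ → ℝ := fun t => t / max (t ^ 2) ((ε / 2) ^ 2)
    let f : ℝ → ℝ := fun t => t - max (-(ε / 2)) (min (ε / 2) t)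
    have hk : Continuous k :=
      continuous_id.div (by fun_prop) fun t => (hmax t).ne'
    have hf : Continuous f := by fun_prop
    have hf0 : f 0 = 0 := by
      simp only [f]
      rw [min_eq_right (by positivity), max_eq_right (by linarith), sub_zero]
    have hkf (t : ℝ) : t * k t * f t = f t := by
      rcases le_or_gt (|t|) (ε / 2) with ht | ht
      · have : f t = 0 := by simp [f, min_eq_right (abs_le.1 ht).2, max_eq_right (abs_le.1 ht).1]
        rw [this, mul_zero]
      · have h1 : (ε / 2) ^ 2 ≤ t ^ 2 := by
          rw [← sq_abs t]
          gcongr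
        have h2 : t ≠ 0 := by
          rintro rfl
          simp at ht
          linarith
        have h3 : t * k t = 1 := by
          simp only [k, max_eq_left h1]
          field_simp
        rw [h3, one_mul]
    have he : cfcₙ (fun t => t * k t) x = x * cfcₙ k x := by
      rw [cfcₙ_mul (fun t : ℝ => t) k x continuousOn_id rfl hk.continuousOn (by simp [k]),
        cfcₙ_id' ℝ x]
    have heI : cfcₙ (fun t => t * k t) x ∈ I := he ▸ hI.mul_mem_right _ hx
    have hef : cfcₙ (fun t => t * k t) x * cfcₙ f x = cfcₙ f x := by
      rw [← cfcₙ_mul (fun t => t * k t) f x (by fun_prop) (by simp) hf.continuousOn hf0]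
      simp_rw [hkf]
    have hfe : cfcₙ f x * cfcₙ (fun t => t * k t) x = cfcₙ f x := by
      rw [← cfcₙ_mul f (fun t => t * k t) x hf.continuousOn hf0 (by fun_prop) (by simp)]
      simp_rw [mul_comm (f _), hkf]
    have hfI : cfcₙ f x ∈ I := hef ▸ hI.mul_mem_right _ heI
    have := finiteDimensional_corner hI hC φ heI hfI hef hfe
    have : IsStarNormal (cfcₙ f x) := (IsSelfAdjoint.cfcₙ (f := f) (a := x)).isStarNormal
    refine ⟨cfcₙ f x, adjoin_le_atomicIdeal
      (mem_adjoin_iff_mem_span.2 (mem_span_isMinimalProjection _)), ?_⟩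
    have hsub : x - cfcₙ f x = cfcₙ (fun t => t - f t) x := by
      rw [cfcₙ_sub (fun t : ℝ => t) f x continuousOn_id rfl hf.continuousOn hf0, cfcₙ_id' ℝ x]
    rw [dist_eq_norm, hsub]
    refine (norm_cfcₙ_le fun t _ => ?_).trans_lt (half_lt_self hε)
    rw [Real.norm_eq_abs, abs_le]
    simp only [f, sub_sub_cancel]
    exact ⟨le_max_left _ _, max_le (by linarith) (min_le_left _ _)⟩
  intro x hx
  have h := realPart_add_I_smul_imaginaryPart x
  have hre : (realPart x : A) ∈ I := by
    rw [realPart_apply_coe]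
    exact I.smul_mem _ (I.add_mem hx (hI.star_mem hx))
  have him : (imaginaryPart x : A) ∈ I := by
    rw [imaginaryPart_apply_coe]
    exact I.smul_mem _ (I.smul_mem _ (I.sub_mem hx (hI.star_mem hx)))
  rw [← h]
  exact add_mem (hsa _ hre (realPart x).2)
    (SMulMemClass.smul_mem _ (hsa _ him (imaginaryPart x).2))

end Compact

/-! ### The atomic representation by compact operators. -/

section Representation

variable {A : Type u} [NonUnitalCStarAlgebra A]

variable (A) in
/-- The nonzero minimal projections. -/
def Atom : Type u := {p : A // IsMinimalProjection p ∧ p ≠ 0}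

namespace Atom

/-- The underlying projection. -/
def val (p : Atom A) : A := Subtype.val p

theorem isMinimal (p : Atom A) : IsMinimalProjection p.val := p.2.1

theorem ne_zero (p : Atom A) : p.val ≠ 0 := p.2.2

/-- The closed left ideal `A p`. -/
def leftIdeal (p : Atom A) : Submodule ℂ A where
  carrier := {x | x * p.val = x}
  add_mem' := fun {x y} hx hy => by
    change (x + y) * p.val = x + y
    rw [add_mul, hx, hy]
  zero_mem' := zero_mul _
  smul_mem' := fun c x hx => by
    change (c • x) * p.val = c • x
    rw [smul_mul_assoc, hx]

theorem mem_leftIdeal {p : Atom A} {x : A} : x ∈ p.leftIdeal ↔ x * p.val = x := Iff.rfl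

theorem val_mul_star {p : Atom A} {x : A} (hx : x * p.val = x) : p.val * star x = star x := by
  have := congrArg star hx
  rwa [star_mul, p.isMinimal.star_eq] at this

instance (p : Atom A) : CompleteSpace p.leftIdeal := by
  have : IsClosed (p.leftIdeal : Set A) :=
    isClosed_eq (continuous_mul_const p.val) continuous_id
  exact this.completeSpace_coe

/-- The scalar `c` with `p a p = c p`. -/
noncomputable def coeff (p : Atom A) (a : A) : ℂ := (p.isMinimal.exists_smul a).choose

theorem coeff_smul (p : Atom A) (a : A) : p.coeff a • p.val = p.val * a * p.val :=
  (p.isMinimal.exists_smul a).choose_spec.symm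

theorem smul_injective (p : Atom A) {c d : ℂ} (h : c • p.val = d • p.val) : c = d :=
  smul_left_injective ℂ p.ne_zero h

theorem coeff_star_mul_smul (p : Atom A) (x y : p.leftIdeal) :
    p.coeff (star (x : A) * y) • p.val = star (x : A) * y := by
  rw [coeff_smul, ← mul_assoc, val_mul_star x.2, mul_assoc, y.2]

/-- The left ideal `A p` is a Hilbert space with `⟪x, y⟫ p = x⋆ y`. -/
noncomputable instance (p : Atom A) : InnerProductSpace ℂ p.leftIdeal where
  inner x y := p.coeff (star (x : A) * y)
  -- The Hilbert norm is the norm of `A`, so completeness comes from `A p` being closed in `A`.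
  norm_sq_eq_re_inner x := by
    have h := coeff_star_mul_smul p x x
    rw [p.isMinimal.star_mul_self_eq p.ne_zero x.2] at h
    have h' := p.smul_injective h
    rw [p.isMinimal.star_mul_self_eq p.ne_zero x.2, h']
    exact (Complex.ofReal_re _).symm
  conj_inner_symm x y := by
    refine p.smul_injective ?_
    have h := congrArg star (coeff_star_mul_smul p y x)
    rw [star_smul, p.isMinimal.star_eq, star_mul, star_star] at h
    rw [coeff_star_mul_smul]
    exact h
  add_left x y z := by
    refine p.smul_injective ?_
    rw [add_smul, coeff_star_mul_smul, coeff_star_mul_smul, coeff_star_mul_smul,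
      Submodule.coe_add, star_add, add_mul]
  smul_left x y c := by
    refine p.smul_injective ?_
    rw [mul_smul, coeff_star_mul_smul, coeff_star_mul_smul, Submodule.coe_smul, star_smul,
      smul_mul_assoc]
    rfl

theorem inner_def (p : Atom A) (x y : p.leftIdeal) :
    inner ℂ x y = p.coeff (star (x : A) * y) := rfl

/-- Left multiplication on `A p`. -/
noncomputable def leftMul (p : Atom A) (a : A) : p.leftIdeal →L[ℂ] p.leftIdeal :=
  LinearMap.mkContinuous
    { toFun x := ⟨a * x, by rw [mem_leftIdeal, mul_assoc, x.2]⟩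
      map_add' x y := Subtype.ext (mul_add a x y)
      map_smul' c x := Subtype.ext (mul_smul_comm c a (x : A)) } ‖a‖
    fun x => norm_mul_le a (x : A)

theorem norm_leftMul_le (p : Atom A) (a : A) : ‖p.leftMul a‖ ≤ ‖a‖ :=
  LinearMap.mkContinuous_norm_le _ (norm_nonneg a) _

/-- Two atoms `p`, `q` are equivalent if `q A p ≠ 0`. -/
instance setoid : Setoid (Atom A) where
  r p q := ∃ a, q.val * a * p.val ≠ 0
  iseqv :=
    { refl p := ⟨p.val, by
        rw [p.isMinimal.mul_self, p.isMinimal.mul_self]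
        exact p.ne_zero⟩
      symm := by
        rintro p q ⟨a, ha⟩
        refine ⟨star a, fun h => ha ?_⟩
        have := congrArg star h
        rwa [star_mul, star_mul, star_star, p.isMinimal.star_eq, q.isMinimal.star_eq, star_zero,
          ← mul_assoc] at this
      trans := by
        rintro p q r ⟨a, ha⟩ ⟨b, hb⟩
        refine ⟨b * q.val * a, fun h => ha ?_⟩
        -- With `x = r b q ≠ 0`, multiplying `x (q a p) = 0` on the left by `x⋆` gives `‖x‖² q a p =
        -- 0`.
        have hx : r.val * b * q.val * q.val = r.val * b * q.val := by
          rw [mul_assoc, q.isMinimal.mul_self]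
        have hxy : r.val * b * q.val * (q.val * a * p.val) = 0 := by
          rw [← h]
          simp only [← mul_assoc, hx]
        have h1 := congrArg (star (r.val * b * q.val) * ·) hxy
        simp only [mul_zero] at h1
        rw [← mul_assoc, q.isMinimal.star_mul_self_eq q.ne_zero hx, smul_mul_assoc, ← mul_assoc,
          ← mul_assoc, q.isMinimal.mul_self] at h1
        exact (smul_eq_zero.1 h1).resolve_left (by simpa using hb) }

theorem equiv_iff {p q : Atom A} : p ≈ q ↔ ∃ a, q.val * a * p.val ≠ 0 := Iff.rfl

end Atom

open Atom

variable (A) in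
/-- The equivalence classes of atoms. -/
abbrev AtomClass : Type u := Quotient (Atom.setoid (A := A))

/-- The Hilbert space `A p` for a chosen representative `p` of a class of atoms. -/
abbrev classSpace (i : AtomClass A) : Type u := ↥(i.out.leftIdeal)

variable (A) in
/-- The Hilbert sum of the spaces `A p`, one for each class of atoms. -/
abbrev atomicSpace : Type u := lp (fun i : AtomClass A => classSpace i) 2

/-- The operator of left multiplication by `a` on the Hilbert sum. -/
noncomputable def atomicOp (a : A) : atomicSpace A →L[ℂ] atomicSpace A :=
  lp.mapCLM 2 (fun i : AtomClass A => i.out.leftMul a) (norm_nonneg a)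
    fun i => i.out.norm_leftMul_le a

theorem atomicOp_apply (a : A) (x : atomicSpace A) (i : AtomClass A) :
    (atomicOp a x i : A) = a * x i := rfl

theorem atomicSpace_ext {x y : atomicSpace A} (h : ∀ i, (x i : A) = y i) : x = y :=
  lp.ext (funext fun i => Subtype.ext (h i))

variable (A) in
/-- The atomic representation of `A`. -/
noncomputable def atomicRep : A →⋆ₙₐ[ℂ] (atomicSpace A →L[ℂ] atomicSpace A) where
  toFun := atomicOp
  map_smul' c a := by
    ext1 x
    exact atomicSpace_ext fun i => smul_mul_assoc c a (x i : A)
  map_zero' := by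
    ext1 x
    exact atomicSpace_ext fun i => zero_mul (x i : A)
  map_add' a b := by
    ext1 x
    exact atomicSpace_ext fun i => add_mul a b (x i : A)
  map_mul' a b := by
    ext1 x
    exact atomicSpace_ext fun i => mul_assoc a b (x i : A)
  map_star' a := by
    rw [ContinuousLinearMap.star_eq_adjoint, ContinuousLinearMap.eq_adjoint_iff]
    intro x y
    rw [lp.inner_eq_tsum, lp.inner_eq_tsum]
    refine tsum_congr fun i => ?_
    rw [inner_def, inner_def, atomicOp_apply, atomicOp_apply, star_mul, star_star, mul_assoc]

theorem atomicRep_apply (a : A) (x : atomicSpace A) (i : AtomClass A) :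
    (atomicRep A a x i : A) = a * x i := rfl

theorem continuous_atomicRep : Continuous (atomicRep A) :=
  AddMonoidHomClass.continuous_of_bound (atomicRep A) 1 fun a => by
    rw [one_mul]
    exact lp.norm_mapCLM_le 2 (fun i : AtomClass A => i.out.leftMul a) (norm_nonneg a)
      fun i => i.out.norm_leftMul_le a

theorem isCompactOperator_of_forall_mem_span {H : Type v} [NormedAddCommGroup H]
    [NormedSpace ℂ H] {T : H →L[ℂ] H} {w : H} (h : ∀ x, T x ∈ Submodule.span ℂ {w}) :
    IsCompactOperator T := by
  have : LocallyCompactSpace (Submodule.span ℂ {w}) :=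
    have := FiniteDimensional.proper ℂ (Submodule.span ℂ {w})
    inferInstance
  have h1 : IsCompactOperator (T.codRestrict _ h) :=
    isCompactOperator_of_locallyCompactSpace_dom _
  exact h1.clm_comp (Submodule.span ℂ {w}).subtypeL

/-- Atoms act as operators of rank one. -/
theorem isCompactOperator_atomicRep_atom (q : Atom A) : IsCompactOperator (atomicRep A q.val) := by
  classical
  set i : AtomClass A := ⟦q⟧ with hi
  obtain ⟨a, ha⟩ := equiv_iff.1 (Quotient.mk_out q : i.out ≈ q)
  set v : A := q.val * a * i.out.val with hv
  have hvp : v * i.out.val = v := by rw [hv, mul_assoc, i.out.isMinimal.mul_self]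
  have hqv : q.val * v = v := by rw [hv, ← mul_assoc, ← mul_assoc, q.isMinimal.mul_self]
  have hvq : star v * q.val = star v := by
    have := congrArg star hqv
    rwa [star_mul, q.isMinimal.star_eq] at this
  have hvv := q.isMinimal.star_mul_self_eq q.ne_zero hvq
  rw [star_star] at hvv
  set l : ℂ := ((‖star v‖ ^ 2 : ℝ) : ℂ) with hl
  have hl0 : l ≠ 0 := by simpa [hl] using ha
  refine isCompactOperator_of_forall_mem_span (w := lp.single 2 i ⟨v, hvp⟩) fun x => ?_
  refine Submodule.mem_span_singleton.2 ⟨l⁻¹ * i.out.coeff (star v * x i), ?_⟩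
  refine atomicSpace_ext fun j => ?_
  rw [atomicRep_apply]
  rcases eq_or_ne j i with rfl | hj
  · have h1 : i.out.coeff (star v * x i) • i.out.val = star v * x i :=
      coeff_star_mul_smul i.out ⟨v, hvp⟩ (x i)
    -- Since `v v⋆ = l q`, one has `l q x = v (v⋆ x)`, and `v⋆ x` acts on `v` from the right as the
    -- scalar `⟪v, x⟫`.
    have h2 : l • (q.val * (x i : A)) = i.out.coeff (star v * x i) • v := by
      rw [← smul_mul_assoc, ← hvv, mul_assoc]
      conv_lhs => rw [← h1, mul_smul_comm, hvp]
    rw [lp.coeFn_smul, Pi.smul_apply, lp.single_apply_self, Submodule.coe_smul, mul_smul, ← h2,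
      smul_smul, inv_mul_cancel₀ hl0, one_smul]
  · rw [lp.coeFn_smul, Pi.smul_apply, lp.single_apply_ne _ _ _ hj, smul_zero]
    -- A nonzero `q x_j` would make `q` equivalent to the representative of `j`, forcing `j = i`.
    by_contra hne
    refine hj ?_
    rw [← Quotient.out_eq j, hi]
    refine Quotient.sound (equiv_iff.2 ⟨x j, fun h => hne ?_⟩)
    rw [mul_assoc, (x j).2] at h
    rw [h]
    rfl

theorem isCompactOperator_atomicRep {a : A} (ha : a ∈ atomicIdeal A) :
    IsCompactOperator (atomicRep A a) := by
  have hclosed : IsClosed {a : A | IsCompactOperator (atomicRep A a)} :=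
    have h : IsClosed {T : atomicSpace A →L[ℂ] atomicSpace A | IsCompactOperator T} :=
      isClosed_setOfPred_isCompactOperator
    h.preimage continuous_atomicRep
  refine closure_minimal (fun x hx => ?_) hclosed ha
  replace hx := mem_adjoin_iff_mem_span.1 hx
  induction hx using Submodule.span_induction with
  | mem p hp =>
    rcases eq_or_ne p 0 with rfl | hp0
    · change IsCompactOperator (atomicRep A 0)
      rw [map_zero]
      exact isCompactOperator_zero
    · exact isCompactOperator_atomicRep_atom ⟨p, hp, hp0⟩
  | zero =>
    change IsCompactOperator (atomicRep A 0)
    rw [map_zero]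
    exact isCompactOperator_zero
  | add x y _ _ hx hy =>
    change IsCompactOperator (atomicRep A (x + y))
    rw [map_add]
    exact hx.add hy
  | smul c x _ hx =>
    change IsCompactOperator (atomicRep A (c • x))
    rw [map_smul]
    exact hx.smul c

/-- Only representatives occur in the Hilbert sum, so `q` is reached through a nonzero `v ∈ p A q`
with `p` the representative: `v⋆ ∈ A p` gives `a v⋆ = 0`, and `v⋆ v` is a nonzero multiple of `q`.
-/
theorem mul_atom_eq_zero {a : A} (ha : atomicRep A a = 0) (q : Atom A) : a * q.val = 0 := by
  classical
  set i : AtomClass A := ⟦q⟧ with hi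
  obtain ⟨b, hb⟩ := equiv_iff.1 (Setoid.symm (Quotient.mk_out q : i.out ≈ q))
  set v : A := i.out.val * b * q.val with hv
  have hvq : v * q.val = v := by rw [hv, mul_assoc, q.isMinimal.mul_self]
  have hpv : star v * i.out.val = star v := by
    rw [hv, star_mul, star_mul, i.out.isMinimal.star_eq, mul_assoc, mul_assoc,
      i.out.isMinimal.mul_self]
  have h1 : a * star v = 0 := by
    have h2 := atomicRep_apply a (lp.single 2 i ⟨star v, hpv⟩) i
    rw [ha, lp.single_apply_self] at h2
    exact h2.symm
  have h3 := congrArg (· * v) h1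
  simp only [zero_mul] at h3
  rw [mul_assoc, q.isMinimal.star_mul_self_eq q.ne_zero hvq, mul_smul_comm] at h3
  exact (smul_eq_zero.1 h3).resolve_left (by simpa using hb)

/-- An element of the kernel annihilates all atoms, hence the whole atomic ideal, which contains
`a⋆`; so `a a⋆ = 0`. -/
theorem eq_zero_of_atomicRep_eq_zero {a : A} (ha : a ∈ atomicIdeal A) (h : atomicRep A a = 0) :
    a = 0 := by
  have hclosed : IsClosed {b : A | a * b = 0} :=
    isClosed_eq (continuous_const_mul a) continuous_const
  have key : atomicIdeal A ≤ {b : A | a * b = 0} := by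
    refine closure_minimal (fun x hx => ?_) hclosed
    replace hx := mem_adjoin_iff_mem_span.1 hx
    have hle : Submodule.span ℂ {p : A | IsMinimalProjection p} ≤
        LinearMap.ker (LinearMap.mulLeft ℂ a) := by
      refine Submodule.span_le.2 fun p hp => ?_
      rcases eq_or_ne p 0 with rfl | hp0
      · exact mul_zero a
      · exact mul_atom_eq_zero h ⟨p, hp, hp0⟩
    exact hle hx
  exact CStarRing.mul_star_self_eq_zero_iff a |>.1 (key (star_mem ha))

theorem isIsoToCompactSubalgebra_atomicIdeal :
    IsIsoToCompactSubalgebra.{u, u} (atomicIdeal A) := by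
  have hc : IsClosed (atomicIdeal A : Set A) := isClosed_atomicIdeal
  let ρ : atomicIdeal A →⋆ₙₐ[ℂ] (atomicSpace A →L[ℂ] atomicSpace A) :=
    (atomicRep A).comp (NonUnitalStarSubalgebraClass.subtype (atomicIdeal A))
  have hinj : Function.Injective ρ := (injective_iff_map_eq_zero ρ).2 fun x hx =>
    Subtype.ext (eq_zero_of_atomicRep_eq_zero x.2 hx)
  refine ⟨atomicSpace A, inferInstance, inferInstance, inferInstance,
    NonUnitalStarAlgHom.range ρ, ?_, ?_, ⟨StarAlgEquiv.ofInjective' ρ hinj⟩⟩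
  · rw [NonUnitalStarAlgHom.coe_range]
    -- An injective `*`-homomorphism of C⋆-algebras is isometric, so its range is closed.
    exact (NonUnitalStarAlgHom.isometry ρ hinj).isClosedEmbedding.isClosed_range
  · intro T hT
    obtain ⟨x, rfl⟩ := (NonUnitalStarAlgHom.mem_range ρ).1 hT
    exact isCompactOperator_atomicRep x.2

end Representation

end CStarAtoms

theorem mainTheorem1 (A : Type u) [NonUnitalCStarAlgebra A] :
    CStarAtoms.IsClosedIdeal (CStarAtoms.atomicIdeal A).toSubmodule ∧
    CStarAtoms.IsIsoToCompactSubalgebra.{u, u} (CStarAtoms.atomicIdeal A) ∧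
    (∀ (I : Submodule ℂ A) (hI : CStarAtoms.IsClosedIdeal I),
      CStarAtoms.IsIsoToCompactSubalgebra.{u, v} hI.toStarSubalgebra →
        I ≤ (CStarAtoms.atomicIdeal A).toSubmodule) ∧
    (∀ (I : Submodule ℂ A) (hI : CStarAtoms.IsEssentialIdeal I),
      CStarAtoms.IsIsoToCompactSubalgebra.{u, v} hI.1.toStarSubalgebra →
        I = (CStarAtoms.atomicIdeal A).toSubmodule) :=
  ⟨CStarAtoms.isClosedIdeal_atomicIdeal, CStarAtoms.isIsoToCompactSubalgebra_atomicIdeal,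
    fun _ hI h => CStarAtoms.le_atomicIdeal_of_compact hI h,
    fun _ hI h => le_antisymm (CStarAtoms.le_atomicIdeal_of_compact hI.1 h) hI.atomicIdeal_le⟩
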